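/- **Theorem 1 (unanimity).** Let $\mu_0,\mu_1$ be probability measures on a measurable space $(\Omega,\mathcal O)$ such that the Radon–Nikodym derivative $\frac{d\mu_1}{d\mu_0}$ exists and is non-zero $\mu_0$-almost everywhere, and such that the log-likelihood ratio $X=\log\frac{d\mu_1}{d\mu_0}(A)$ has a non-atomic distribution when $A\sim\frac12\mu_0+\frac12\mu_1$. Let $n$ be a finite number of agents, and let $(S,A_1,\dots,A_n)\in\{0,1\}\times\Omega^n$ have law $$\mathbb P=\tfrac12\,\delta_0\otimes\mu_0^{\otimes n}+\tfrac12\,\delta_1\otimes\mu_1^{\otimes n},$$ where $\delta_s$ is the point mass at $s$; that is, the state $S$ is uniform on $\{0,1\}$ and, given $S$, the private signals $A_1,\dots,A_n$ are i.i.d. with distribution $\mu_S$. For $t=1,2,\dots$ and each agent $i$, the vote of agent $i$ in round $t$ is defined recursively by $$V_i(t)=\begin{cases}1&\text{if }\ \mathbb P\big[S=1\mid A_i,\ V_j(t')\ (1\le j\le n,\ 1\le t'<t)\big]>\tfrac12,\\ 0&\text{otherwise.}\end{cases}$$ Then with $\mathbb P$-probability one there exist a time $t_u\ge 1$ and a vote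 $V\in\{0,1\}$ such that $V_i(t)=V$ for all $t\ge t_u$ and all agents $i$. -/

import Mathlib

open MeasureTheory ProbabilityTheory
open scoped ENNReal

namespace RepeatedVoting

variable {Ω : Type*} [MeasurableSpace Ω]

/-- The standing assumptions on the signal distributions: `dμ₁/dμ₀` exists and is non-zero
(almost everywhere, which is the same as having a version that is non-zero at every point), and
the log-likelihood ratio `X = log (dμ₁/dμ₀)(A)`, `A ∼ ½ μ₀ + ½ μ₁`, has a non-atomic
distribution. -/
structure IsAdmissible (μ₀ μ₁ : Measure Ω) : Prop where
  absolutelyContinuous : μ₁ ≪ μ₀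
  rnDeriv_ne_zero : ∀ᵐ ω ∂μ₀, μ₁.rnDeriv μ₀ ω ≠ 0
  nonatomic : ∀ x : ℝ,
    (((1 / 2 : ℝ≥0∞) • μ₀ + (1 / 2 : ℝ≥0∞) • μ₁).map (llr μ₁ μ₀)) {x} = 0

/-- The sample space `{0,1} × Ωⁿ`. -/
abbrev Outcome (n : ℕ) (Ω : Type*) : Type _ := Fin 2 × (Fin n → Ω)

/-- The state of the world `S`. -/
def state {n : ℕ} (z : Outcome n Ω) : Fin 2 := z.1

/-- The private signal `A_i`. -/
def signal {n : ℕ} (i : Fin n) (z : Outcome n Ω) : Ω := z.2 i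

/-- The law `½ δ₀ ⊗ μ₀^{⊗ n} + ½ δ₁ ⊗ μ₁^{⊗ n}` of the state and the signals. -/
noncomputable def law (n : ℕ) (μ₀ μ₁ : Measure Ω) : Measure (Outcome n Ω) :=
  (1 / 2 : ℝ≥0∞) • (Measure.dirac (0 : Fin 2)).prod (Measure.pi fun _ : Fin n => μ₀) +
    (1 / 2 : ℝ≥0∞) • (Measure.dirac (1 : Fin 2)).prod (Measure.pi fun _ : Fin n => μ₁)

/-- The vote of agent `i` when its information consists of its signal and of the `σ`-algebra `𝓗`:
`1` if `ℙ(S = 1 | A_i, 𝓗) > 1/2`, and `0` otherwise. -/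
noncomputable def voteGiven {n : ℕ} (μ₀ μ₁ : Measure Ω) (𝓗 : MeasurableSpace (Outcome n Ω))
    (i : Fin n) (z : Outcome n Ω) : Fin 2 :=
  if 1 / 2 <
      ((law n μ₀ μ₁)⟦{y | state y = 1} | MeasurableSpace.comap (signal i) inferInstance ⊔ 𝓗⟧) z
  then 1 else 0

/-- The `σ`-algebra generated by the votes of all agents in the rounds `1, …, t`. -/
@[reducible]
noncomputable def publicInfo {n : ℕ} (μ₀ μ₁ : Measure Ω) : ℕ → MeasurableSpace (Outcome n Ω)
  | 0 => ⊥
  | t + 1 => publicInfo μ₀ μ₁ t ⊔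
      ⨆ j : Fin n, MeasurableSpace.comap (voteGiven μ₀ μ₁ (publicInfo μ₀ μ₁ t) j) inferInstance

/-- `V_i(t)`, the vote of agent `i` in round `t`, for `t ≥ 1` (the value at `t = 0` has no
meaning). -/
noncomputable def vote {n : ℕ} (μ₀ μ₁ : Measure Ω) (t : ℕ) (i : Fin n) :
    Outcome n Ω → Fin 2 :=
  voteGiven μ₀ μ₁ (publicInfo μ₀ μ₁ (t - 1)) i

/-- The public information after round `t` is generated by the votes in the rounds `1, …, t`. -/
theorem publicInfo_eq {n : ℕ} (μ₀ μ₁ : Measure Ω) (t : ℕ) :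
    publicInfo (n := n) μ₀ μ₁ t =
      ⨆ s ∈ Finset.Icc 1 t, ⨆ j : Fin n,
        MeasurableSpace.comap (vote μ₀ μ₁ s j) inferInstance := by
  induction t with
  | zero => simp [publicInfo]
  | succ t ih =>
    rw [← Finset.insert_Icc_right_eq_Icc_add_one (by omega), Finset.iSup_insert, ← ih, sup_comm,
      publicInfo]
    rfl

/-- The information of each agent is a sub-`σ`-algebra of the one on the sample space, so that the
conditional probabilities above are the genuine ones. -/
theorem info_le {n : ℕ} (μ₀ μ₁ : Measure Ω) (t : ℕ) (i : Fin n) :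
    MeasurableSpace.comap (signal i) inferInstance ⊔ publicInfo μ₀ μ₁ t ≤
      (inferInstance : MeasurableSpace (Outcome n Ω)) := by
  have hs : ∀ j : Fin n, MeasurableSpace.comap (signal j) inferInstance ≤
      (inferInstance : MeasurableSpace (Outcome n Ω)) := fun j =>
    Measurable.comap_le ((measurable_pi_apply j).comp measurable_snd)
  refine sup_le (hs i) ?_
  induction t with
  | zero => exact bot_le
  | succ t ih =>
    refine sup_le ih (iSup_le fun j => Measurable.comap_le ?_)
    refine Measurable.ite (measurableSet_lt measurable_const ?_) measurable_const measurable_const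
    exact stronglyMeasurable_condExp.measurable.mono (sup_le (hs j) ih) le_rfl

end RepeatedVoting

/-!
Where the limit of the public belief is not `1/2`, unanimity is easy: an agent voting `0` infinitely
often has limit belief at most `1/2`, and by the tower property so has the public, and likewise for
`1`. So every agent eventually votes on the side of the public belief.

Where the public limit belief is `1/2`, it agrees with the limit belief of each agent, since one
dominates the other on the public event that the agent votes `0` (or `1`) infinitely often. As the
public information is a box constraint on the independent signals, the odds of an agent are the
likelihood ratio of its own signal times a publicly known factor, so in the limit that likelihood
ratio becomes publicly known. The public belief is then the posterior given all signals, so the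
likelihood ratios multiply to `1`, which non-atomicity excludes almost surely.
-/

namespace RepeatedVoting

open Filter Topology Set
open scoped NNReal

section ConditionalExpectation

variable {α β : Type*} {m₀ : MeasurableSpace α} [MeasurableSpace β]

theorem condExp_mem_of_condExp_mem_on {E : Type*} [NormedAddCommGroup E] [NormedSpace ℝ E]
    [CompleteSpace E] {P : Measure α} [IsFiniteMeasure P] {H G : MeasurableSpace α} {f : α → E}
    {N : Set α} {K : Set E} (hHG : H ≤ G) (hG : G ≤ m₀) (hN : MeasurableSet[H] N)
    (hKc : IsClosed K) (hK : Convex ℝ K) (h : ∀ᵐ z ∂P, z ∈ N → P[f | G] z ∈ K) :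
    ∀ᵐ z ∂P, z ∈ N → P[f | H] z ∈ K := by
  have hH := hHG.trans hG
  have hint : Integrable (P[f | G]) P := integrable_condExp
  rw [← ae_restrict_iff' (hH _ hN)] at h ⊢
  filter_upwards [hK.condExp_mem hH hint.restrict hKc h,
    condExp_restrict_ae_eq_restrict hH hN hint,
    ae_restrict_of_ae (condExp_condExp_of_le (f := f) hHG hG)] with z hz hrestrict htower
  rwa [← htower, ← hrestrict]

theorem condExp_eq_on_of_le_on {P : Measure α} [IsFiniteMeasure P] {m₁ m₂ : MeasurableSpace α}
    {f : α → ℝ} {N : Set α} (hm₁ : m₁ ≤ m₀) (hm₂ : m₂ ≤ m₀) (hf : Integrable f P)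
    (hN₁ : MeasurableSet[m₁] N) (hN₂ : MeasurableSet[m₂] N)
    (h : ∀ᵐ z ∂P, z ∈ N → P[f | m₁] z ≤ P[f | m₂] z) :
    ∀ᵐ z ∂P, z ∈ N → P[f | m₁] z = P[f | m₂] z := by
  rw [← ae_restrict_iff' (hm₁ _ hN₁)] at h ⊢
  refine (integral_eq_iff_of_ae_le integrable_condExp.restrict integrable_condExp.restrict h).1 ?_
  rw [setIntegral_condExp hm₁ hf hN₁, setIntegral_condExp hm₂ hf hN₂]

theorem condExp_eq_on_of_eq_stronglyMeasurable_on {E : Type*} [NormedAddCommGroup E]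
    [NormedSpace ℝ E] [CompleteSpace E] {P : Measure α} [IsFiniteMeasure P]
    {H G : MeasurableSpace α} {f q : α → E} {N : Set α} (hHG : H ≤ G) (hG : G ≤ m₀)
    (hN : MeasurableSet[H] N) (hq : StronglyMeasurable[H] q)
    (h : ∀ᵐ z ∂P, z ∈ N → P[f | G] z = q z) :
    ∀ᵐ z ∂P, z ∈ N → P[f | H] z = q z := by
  have hH := hHG.trans hG
  have hint : Integrable (P[f | G]) P := integrable_condExp
  rw [← ae_restrict_iff' (hH _ hN)] at h ⊢
  have hGH : AEStronglyMeasurable[H] (P[f | G]) (P.restrict N) := ⟨q, hq, h⟩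
  filter_upwards [h, condExp_of_aestronglyMeasurable' hH hGH hint.restrict,
    condExp_restrict_ae_eq_restrict hH hN hint,
    ae_restrict_of_ae (condExp_condExp_of_le (f := f) hHG hG)] with z hz hself hrestrict htower
  rw [← htower, ← hrestrict, hself, hz]

theorem withDensity_div_one_add (ν : Measure β) {r : β → ℝ≥0} (hr : Measurable r) :
    (ν + ν.withDensity fun b => r b).withDensity (fun b => (r b / (1 + r b) : ℝ≥0)) =
      ν.withDensity fun b => r b := by
  have hsum : ν + ν.withDensity (fun b => (r b : ℝ≥0∞)) =
      ν.withDensity fun b => ((1 + r b : ℝ≥0) : ℝ≥0∞) := by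
    simp only [ENNReal.coe_add, ENNReal.coe_one]
    exact (congrArg (· + _) withDensity_one.symm).trans (withDensity_add_left measurable_one _).symm
  rw [hsum, ← withDensity_mul _ (by fun_prop) (by fun_prop)]
  congr 1 with b
  rw [Pi.mul_apply, ← ENNReal.coe_mul, mul_div_cancel₀ _ (by positivity)]

/-- Bayes' rule in odds form; `Q₀` and `Q₁` are the restrictions of one law to `Sᶜ` and to `S`. -/
theorem condExp_indicator_comap_ae_eq {f : α → β} (hf : Measurable f) {Q₀ Q₁ : Measure α}
    [IsFiniteMeasure Q₀] [IsFiniteMeasure Q₁] {S : Set α} (hS : MeasurableSet S)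
    (hQ₀ : Q₀ S = 0) (hQ₁ : Q₁ Sᶜ = 0) {r : β → ℝ≥0} (hr : Measurable r)
    (h : Q₁.map f = (Q₀.map f).withDensity fun b => r b) :
    (Q₀ + Q₁)⟦S | MeasurableSpace.comap f inferInstance⟧
      =ᵐ[Q₀ + Q₁] fun z => (r (f z) : ℝ) / (1 + r (f z)) := by
  let q : β → ℝ≥0 := fun b => r b / (1 + r b)
  have hq : Measurable q := by fun_prop
  have hq_le (b : β) : q b ≤ 1 := div_le_one_of_le₀ le_add_self zero_le
  have hmap : ((Q₀ + Q₁).map f).withDensity (fun b => q b) = Q₁.map f := by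
    rw [Measure.map_add _ _ hf, h]
    exact withDensity_div_one_add _ hr
  have hcoe : (fun z => (r (f z) : ℝ) / (1 + r (f z))) = fun z => (q (f z) : ℝ) := by
    ext z; simp [q]
  have hqf : AEStronglyMeasurable (fun z => (q (f z) : ℝ)) (Q₀ + Q₁) :=
    (hq.comp hf).coe_nnreal_real.aestronglyMeasurable
  rw [hcoe]
  refine (ae_eq_condExp_of_forall_setIntegral_eq hf.comap_le
    ((integrable_const (1 : ℝ)).indicator hS) (fun D _ _ => ?_) ?_ ?_).symm
  · refine (Integrable.of_bound hqf 1 (ae_of_all _ fun z => ?_)).integrableOn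
    simpa using hq_le (f z)
  · rintro _ ⟨T, hT, rfl⟩ -
    have hlint : ∫⁻ z in f ⁻¹' T, q (f z) ∂(Q₀ + Q₁) = Q₁ (f ⁻¹' T) := by
      rw [← setLIntegral_map (f := fun b => (q b : ℝ≥0∞)) hT hq.coe_nnreal_ennreal hf,
        ← withDensity_apply _ hT, hmap, Measure.map_apply hf hT]
    have hinter : (Q₀ + Q₁) (f ⁻¹' T ∩ S) = Q₁ (f ⁻¹' T) := by
      rw [Measure.add_apply, measure_mono_null inter_subset_right hQ₀, zero_add,
        measure_inter_conull' (measure_mono_null (fun z hz => hz.2) hQ₁)]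
    rw [setIntegral_indicator hS, integral_eq_lintegral_of_nonneg_ae
      (ae_of_all _ fun z => NNReal.coe_nonneg _) hqf.restrict]
    simp only [ENNReal.ofReal_coe_nnreal, hlint, integral_const, smul_eq_mul, mul_one,
      measureReal_def, Measure.restrict_apply_univ, hinter]
  · exact (hq.coe_nnreal_real.comp (comap_measurable f)).aestronglyMeasurable

end ConditionalExpectation

section ProductMeasure

variable {ι : Type*} {X : ι → Type*} [∀ i, MeasurableSpace (X i)]

theorem pi_withDensity [Fintype ι] (μ : ∀ i, Measure (X i)) [∀ i, IsProbabilityMeasure (μ i)]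
    {f : ∀ i, X i → ℝ≥0} (hf : ∀ i, Measurable (f i)) :
    Measure.pi (fun i => (μ i).withDensity fun a => f i a) =
      (Measure.pi μ).withDensity fun x => ((∏ i, f i (x i) : ℝ≥0) : ℝ≥0∞) := by
  classical
  refine Measure.pi_eq fun B hB => ?_
  have hfB (i : ι) : Measurable ((B i).indicator fun a => (f i a : ℝ≥0∞)) :=
    (hf i).coe_nnreal_ennreal.indicator (hB i)
  have hind : (univ.pi B).indicator (fun x => ((∏ i, f i (x i) : ℝ≥0) : ℝ≥0∞)) =
      fun x => ∏ i, (B i).indicator (fun a => (f i a : ℝ≥0∞)) (x i) := by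
    ext x
    simp only [indicator_apply, ENNReal.ofNNReal_finsetProd, Finset.prod_ite_zero, mem_univ_pi,
      Finset.mem_univ, true_imp_iff]
  rw [withDensity_apply _ (.univ_pi hB), ← lintegral_indicator (.univ_pi hB), hind,
    lintegral_prod_eq_prod_lintegral_of_indepFun Finset.univ
      (fun i (x : ∀ i, X i) => (B i).indicator (fun a => (f i a : ℝ≥0∞)) (x i))
      (iIndepFun_pi fun i => (hfB i).aemeasurable)
      fun i => (hfB i).comp (measurable_pi_apply i)]
  refine Finset.prod_congr rfl fun i _ => ?_
  rw [(measurePreserving_eval μ i).lintegral_comp (hfB i), lintegral_indicator (hB i),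
    withDensity_apply _ (hB i)]

theorem ae_pi_prod_ne_one {M Ω : Type*} [CommMonoid M] [MeasurableSpace M] [MeasurableMul₂ M]
    [MeasurableSingletonClass M] [MeasurableSpace Ω] {m : ℕ} (μ : Fin (m + 1) → Measure Ω)
    [∀ i, SigmaFinite (μ i)] {l : Ω → M} (hl : Measurable l) (hnull : ∀ c, μ 0 (l ⁻¹' {c}) = 0) :
    ∀ᵐ x ∂Measure.pi μ, ∏ i, l (x i) ≠ 1 := by
  have hT : MeasurableSet {p : (Fin m → Ω) × Ω | l p.2 * ∏ i, l (p.1 i) = 1} :=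
    Measurable.mul (by fun_prop) (by fun_prop) (measurableSet_singleton 1)
  have hnull_T : ((Measure.pi fun i => μ (Fin.succ i)).prod (μ 0))
      {p | l p.2 * ∏ i, l (p.1 i) = 1} = 0 := by
    rw [Measure.measure_prod_null hT]
    refine ae_of_all _ fun y => ?_
    obtain hempty | ⟨a, ha⟩ := (Prod.mk y ⁻¹' {p | l p.2 * ∏ i, l (p.1 i) = 1}).eq_empty_or_nonempty
    · simp [hempty]
    · exact measure_mono_null
        (fun b hb => left_inv_eq_right_inv hb ((mul_comm _ _).trans ha)) (hnull (l a))
  have hmp := Measure.measurePreserving_swap.comp (measurePreserving_piFinSuccAbove μ 0)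
  refine (hmp.quasiMeasurePreserving.ae (measure_eq_zero_iff_ae_notMem.1 hnull_T)).mono
    fun x hx hprod => hx ?_
  simpa [Fin.prod_univ_succ, Fin.tail] using hprod

theorem setLIntegral_pi_eval [Fintype ι] [DecidableEq ι] (μ : ∀ i, Measure (X i))
    [∀ i, SigmaFinite (μ i)] (B : ∀ i, Set (X i)) (j : ι) {φ : X j → ℝ≥0∞} (hφ : Measurable φ) :
    ∫⁻ x in univ.pi B, φ (x j) ∂Measure.pi μ =
      (∏ i ∈ Finset.univ.erase j, μ i (B i)) * ∫⁻ a in B j, φ a ∂μ j := by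
  rw [Measure.restrict_pi_pi, ← lintegral_map (g := Function.eval j) hφ (measurable_pi_apply j),
    Measure.pi_map_eval]
  simp

theorem lintegral_pi_eval_prodMk_eq_sum [Fintype ι] [DecidableEq ι] {K : Type*} [Fintype K]
    [MeasurableSpace K] {F : (∀ i, X i) → K} {B : K → ∀ i, Set (X i)}
    (hB : ∀ k i, MeasurableSet (B k i)) (hF : ∀ k, F ⁻¹' {k} = univ.pi (B k))
    (μ : ∀ i, Measure (X i)) [∀ i, SigmaFinite (μ i)] (j : ι) {φ : X j × K → ℝ≥0∞}
    (hφ : Measurable φ) :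
    ∫⁻ x, φ (x j, F x) ∂Measure.pi μ =
      ∑ k, (∏ i ∈ Finset.univ.erase j, μ i (B k i)) * ∫⁻ a in B k j, φ (a, k) ∂μ j := by
  have hF_meas (k : K) : MeasurableSet (F ⁻¹' {k}) := hF k ▸ .univ_pi (hB k)
  have hdisj : Pairwise (Function.onFun Disjoint fun k => F ⁻¹' {k}) := fun k k' hkk' =>
    (disjoint_singleton.2 hkk').preimage F
  have hcover : ⋃ k, F ⁻¹' {k} = univ := iUnion_eq_univ_iff.2 fun x => ⟨F x, rfl⟩
  rw [← setLIntegral_univ, ← hcover, lintegral_iUnion hF_meas hdisj, tsum_fintype]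
  refine Finset.sum_congr rfl fun k _ => ?_
  rw [← setLIntegral_pi_eval μ (B k) j (φ := fun a => φ (a, k))
    (hφ.comp measurable_prodMk_right), ← hF k]
  exact setLIntegral_congr_fun (hF_meas k) fun x hx => by rw [show F x = k from hx]

/-- A statistic of a profile of signals such that knowing its value amounts to separate measurable
constraints on the individual signals, so that independent signals remain independent given it. -/
def HasBoxFibers {K : Type*} (F : (∀ i, X i) → K) : Prop :=
  ∀ k, ∃ B : ∀ i, Set (X i), (∀ i, MeasurableSet (B i)) ∧ F ⁻¹' {k} = univ.pi B

namespace HasBoxFibers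

variable {K : Type*} [MeasurableSpace K] {F : (∀ i, X i) → K}

theorem measurable [Countable ι] [Countable K] (hF : HasBoxFibers F) : Measurable F := by
  refine measurable_to_countable' fun k => ?_
  obtain ⟨B, hB, hk⟩ := hF k
  exact hk ▸ .univ_pi hB

theorem prodMk (hF : HasBoxFibers F) {V : Type*} [MeasurableSpace V] [MeasurableSingletonClass V]
    {v : ∀ i, X i × K → V} (hv : ∀ i, Measurable (v i)) :
    HasBoxFibers fun x => (F x, fun i => v i (x i, F x)) := by
  rintro ⟨k, b⟩
  obtain ⟨B, hB, hk⟩ := hF k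
  refine ⟨fun i => B i ∩ {a | v i (a, k) = b i}, fun i => (hB i).inter
    ((hv i).comp measurable_prodMk_right (measurableSet_singleton (b i))), ?_⟩
  ext x
  have hx : F x = k ↔ ∀ i, x i ∈ B i := by simpa using Set.ext_iff.1 hk x
  simp only [mem_preimage, mem_singleton_iff, Prod.mk.injEq, funext_iff, mem_univ_pi, mem_inter_iff,
    mem_ofPred_eq, forall_and, ← hx]
  exact and_congr_right fun hxk => by rw [hxk]

theorem exists_map_eval_prodMk_eq_withDensity [Fintype ι] [Finite K] [MeasurableSingletonClass K]
    (hF : HasBoxFibers F) {μ ν : ∀ i, Measure (X i)}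
    [∀ i, IsFiniteMeasure (μ i)] [∀ i, IsFiniteMeasure (ν i)] (hac : ∀ i, ν i ≪ μ i) (j : ι)
    {l : X j → ℝ≥0} (hl : Measurable l) (hν : ν j = (μ j).withDensity fun a => l a) :
    ∃ γ : K → ℝ≥0, (Measure.pi ν).map (fun x => (x j, F x)) =
      ((Measure.pi μ).map fun x => (x j, F x)).withDensity
        fun p => ((l p.1 * γ p.2 : ℝ≥0) : ℝ≥0∞) := by
  classical
  have := Fintype.ofFinite K
  have hjF : Measurable fun x => (x j, F x) := (measurable_pi_apply j).prodMk hF.measurable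
  choose B hB hBF using hF
  let γ : K → ℝ≥0 := fun k => ∏ i ∈ Finset.univ.erase j, (ν i (B k i) / μ i (B k i)).toNNReal
  have hγ (k : K) : ∏ i ∈ Finset.univ.erase j, ν i (B k i) =
      γ k * ∏ i ∈ Finset.univ.erase j, μ i (B k i) := by
    rw [ENNReal.ofNNReal_finsetProd, ← Finset.prod_mul_distrib]
    refine Finset.prod_congr rfl fun i _ => ?_
    by_cases h0 : μ i (B k i) = 0
    · simp [h0, hac i h0]
    · rw [ENNReal.coe_toNNReal (ENNReal.div_ne_top (measure_ne_top _ _) h0),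
        ENNReal.div_mul_cancel h0 (measure_ne_top _ _)]
  have hγ_meas : Measurable γ := measurable_of_finite γ
  have hlγ : Measurable fun p : X j × K => ((l p.1 * γ p.2 : ℝ≥0) : ℝ≥0∞) := by fun_prop
  refine ⟨γ, Measure.ext_of_lintegral _ fun φ hφ => ?_⟩
  rw [lintegral_withDensity_eq_lintegral_mul _ hlγ hφ, lintegral_map hφ hjF,
    lintegral_map (hlγ.mul hφ) hjF, lintegral_pi_eval_prodMk_eq_sum hB hBF ν j hφ,
    lintegral_pi_eval_prodMk_eq_sum hB hBF μ j (hlγ.mul hφ)]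
  refine Finset.sum_congr rfl fun k _ => ?_
  have hφk : Measurable fun a => φ (a, k) := hφ.comp measurable_prodMk_right
  rw [hγ, hν, setLIntegral_withDensity_eq_setLIntegral_mul _ (by fun_prop) hφk (hB k j)]
  have hlφ : Measurable fun a => (l a : ℝ≥0∞) * φ (a, k) := by fun_prop
  simp only [Pi.mul_apply, ENNReal.coe_mul, mul_right_comm _ (γ k : ℝ≥0∞)]
  rw [lintegral_mul_const _ hlφ, mul_assoc, mul_left_comm, mul_comm (γ k : ℝ≥0∞)]

end HasBoxFibers

end ProductMeasure

section Model

variable {n : ℕ} {Ω : Type*} [MeasurableSpace Ω]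

/-- The likelihood ratio `dμ₁/dμ₀` of a signal, with its (negligible) infinite values replaced by
`0`. -/
noncomputable def likelihoodRatio (μ₀ μ₁ : Measure Ω) (a : Ω) : ℝ≥0 :=
  (μ₁.rnDeriv μ₀ a).toNNReal

theorem measurable_likelihoodRatio (μ₀ μ₁ : Measure Ω) : Measurable (likelihoodRatio μ₀ μ₁) :=
  (μ₁.measurable_rnDeriv μ₀).ennreal_toNNReal

theorem withDensity_likelihoodRatio {μ₀ μ₁ : Measure Ω} [SigmaFinite μ₁]
    [μ₁.HaveLebesgueDecomposition μ₀] (hac : μ₁ ≪ μ₀) :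
    μ₀.withDensity (fun a => likelihoodRatio μ₀ μ₁ a) = μ₁ := by
  conv_rhs => rw [← Measure.withDensity_rnDeriv_eq μ₁ μ₀ hac]
  exact withDensity_congr_ae ((μ₁.rnDeriv_lt_top μ₀).mono fun a ha => ENNReal.coe_toNNReal ha.ne)

/-- The law of the state and the signals given that the state is `s`, when the signals are then
distributed according to `μ`. -/
noncomputable def stateLaw (n : ℕ) (s : Fin 2) (μ : Measure Ω) : Measure (Outcome n Ω) :=
  (Measure.dirac s).prod (Measure.pi fun _ => μ)

instance isProbabilityMeasure_stateLaw (s : Fin 2) (μ : Measure Ω) [IsProbabilityMeasure μ] :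
    IsProbabilityMeasure (stateLaw n s μ) := by
  unfold stateLaw; infer_instance

theorem law_eq_add (n : ℕ) (μ₀ μ₁ : Measure Ω) :
    law n μ₀ μ₁ = (1 / 2 : ℝ≥0∞) • stateLaw n 0 μ₀ + (1 / 2 : ℝ≥0∞) • stateLaw n 1 μ₁ := rfl

instance isProbabilityMeasure_law (μ₀ μ₁ : Measure Ω) [IsProbabilityMeasure μ₀]
    [IsProbabilityMeasure μ₁] : IsProbabilityMeasure (law n μ₀ μ₁) :=
  ⟨by simp [law_eq_add, ENNReal.inv_two_add_inv_two]⟩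

theorem map_snd_stateLaw (s : Fin 2) (μ : Measure Ω) [IsProbabilityMeasure μ] :
    (stateLaw n s μ).map Prod.snd = Measure.pi fun _ => μ :=
  measurePreserving_snd.map_eq

theorem ae_stateLaw_state_eq (s : Fin 2) (μ : Measure Ω) [IsProbabilityMeasure μ] :
    ∀ᵐ z ∂stateLaw n s μ, state z = s :=
  measurePreserving_fst.quasiMeasurePreserving.ae ((ae_dirac_iff (measurableSet_singleton s)).2 rfl)

theorem ae_law_of_ae_pi {μ₀ μ₁ : Measure Ω} [IsProbabilityMeasure μ₀] [IsProbabilityMeasure μ₁]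
    {p : (Fin n → Ω) → Prop} (h₀ : ∀ᵐ x ∂Measure.pi fun _ => μ₀, p x)
    (h₁ : ∀ᵐ x ∂Measure.pi fun _ => μ₁, p x) : ∀ᵐ z ∂law n μ₀ μ₁, p z.2 := by
  rw [law_eq_add, ae_add_measure_iff, Measure.ae_ennreal_smul_measure_iff (by simp),
    Measure.ae_ennreal_smul_measure_iff (by simp)]
  exact ⟨measurePreserving_snd.quasiMeasurePreserving.ae h₀,
    measurePreserving_snd.quasiMeasurePreserving.ae h₁⟩

theorem measurableSet_state : MeasurableSet {z : Outcome n Ω | state z = 1} :=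
  measurable_fst (measurableSet_singleton (1 : Fin 2))

theorem condExp_state_comap_ae_eq {β : Type*} [MeasurableSpace β] {μ₀ μ₁ : Measure Ω}
    [IsProbabilityMeasure μ₀] [IsProbabilityMeasure μ₁] {G : (Fin n → Ω) → β} (hG : Measurable G)
    {r : β → ℝ≥0} (hr : Measurable r)
    (h : (Measure.pi fun _ => μ₁).map G =
      ((Measure.pi fun _ => μ₀).map G).withDensity fun b => r b) :
    (law n μ₀ μ₁)⟦{z | state z = 1} | MeasurableSpace.comap (fun z => G z.2) inferInstance⟧
      =ᵐ[law n μ₀ μ₁] fun z => (r (G z.2) : ℝ) / (1 + r (G z.2)) := by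
  have hmap (s : Fin 2) (μ : Measure Ω) [IsProbabilityMeasure μ] :
      ((1 / 2 : ℝ≥0∞) • stateLaw n s μ).map (G ∘ Prod.snd) =
        (1 / 2 : ℝ≥0∞) • (Measure.pi fun _ => μ).map G := by
    rw [Measure.map_smul, ← map_snd_stateLaw s μ, Measure.map_map hG measurable_snd]
  have : IsFiniteMeasure ((1 / 2 : ℝ≥0∞) • stateLaw n 0 μ₀) := Measure.smul_finite _ (by simp)
  have : IsFiniteMeasure ((1 / 2 : ℝ≥0∞) • stateLaw n 1 μ₁) := Measure.smul_finite _ (by simp)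
  rw [law_eq_add]
  refine condExp_indicator_comap_ae_eq (hG.comp measurable_snd) measurableSet_state ?_ ?_ hr ?_
  · refine Measure.smul_absolutelyContinuous (measure_mono_null ?_ (ae_stateLaw_state_eq 0 μ₀))
    intro z (hz : state z = 1)
    simp [hz]
  · exact Measure.smul_absolutelyContinuous (ae_stateLaw_state_eq 1 μ₁)
  · rw [hmap, hmap, h, withDensity_smul_measure]

theorem measurable_voteGiven (μ₀ μ₁ : Measure Ω) (𝓗 : MeasurableSpace (Outcome n Ω)) (i : Fin n) :
    Measurable[MeasurableSpace.comap (signal i) inferInstance ⊔ 𝓗] (voteGiven μ₀ μ₁ 𝓗 i) :=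
  Measurable.ite (measurableSet_lt measurable_const stronglyMeasurable_condExp.measurable)
    measurable_const measurable_const

theorem comap_signal_sup_comap {K : Type*} [MeasurableSpace K] (F : (Fin n → Ω) → K) (i : Fin n) :
    MeasurableSpace.comap (signal i) inferInstance ⊔
        MeasurableSpace.comap (fun z : Outcome n Ω => F z.2) inferInstance =
      MeasurableSpace.comap (fun z : Outcome n Ω => (z.2 i, F z.2)) inferInstance :=
  (MeasurableSpace.comap_prodMk _ _).symm

theorem exists_publicInfo_eq_comap (μ₀ μ₁ : Measure Ω) (t : ℕ) :
    ∃ (K : Type) (_ : Finite K) (_ : MeasurableSpace K) (_ : MeasurableSingletonClass K)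
      (F : (Fin n → Ω) → K), HasBoxFibers F ∧
        publicInfo μ₀ μ₁ t = MeasurableSpace.comap (fun z => F z.2) inferInstance := by
  induction t with
  | zero =>
    refine ⟨Unit, inferInstance, inferInstance, inferInstance, fun _ => (), fun _ => ?_, ?_⟩
    · exact ⟨fun _ => univ, fun _ => .univ, by ext; simp⟩
    · exact (MeasurableSpace.comap_const ()).symm
  | succ t ih =>
    obtain ⟨K, _, _, _, F, hF, hK⟩ := ih
    have hfactor (i : Fin n) : ∃ v : Ω × K → Fin 2, Measurable v ∧
        voteGiven μ₀ μ₁ (publicInfo μ₀ μ₁ t) i = v ∘ fun z => (z.2 i, F z.2) := by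
      refine Measurable.exists_eq_measurable_comp ?_
      rw [← comap_signal_sup_comap, ← hK]
      exact measurable_voteGiven μ₀ μ₁ _ i
    choose v hv hvote using hfactor
    refine ⟨K × (Fin n → Fin 2), inferInstance, inferInstance, inferInstance,
      fun x => (F x, fun i => v i (x i, F x)), hF.prodMk hv, ?_⟩
    rw [publicInfo, ← MeasurableSpace.comap_process_pi, hK]
    simp only [hK ▸ hvote]
    exact (MeasurableSpace.comap_prodMk _ _).symm

theorem publicInfo_le_comap_snd (μ₀ μ₁ : Measure Ω) (t : ℕ) :
    publicInfo (n := n) μ₀ μ₁ t ≤ MeasurableSpace.comap Prod.snd inferInstance := by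
  obtain ⟨K, _, _, _, F, hF, hK⟩ := exists_publicInfo_eq_comap (n := n) μ₀ μ₁ t
  exact hK ▸ (hF.measurable.comp (comap_measurable Prod.snd)).comap_le

theorem condExp_state_comap_snd_ae_eq {μ₀ μ₁ : Measure Ω} [IsProbabilityMeasure μ₀]
    [IsProbabilityMeasure μ₁] (hac : μ₁ ≪ μ₀) :
    (law n μ₀ μ₁)⟦{z | state z = 1} | MeasurableSpace.comap Prod.snd inferInstance⟧
      =ᵐ[law n μ₀ μ₁] fun z => ((∏ i, likelihoodRatio μ₀ μ₁ (signal i z) : ℝ≥0) : ℝ) /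
        (1 + (∏ i, likelihoodRatio μ₀ μ₁ (signal i z) : ℝ≥0)) := by
  have hl := measurable_likelihoodRatio μ₀ μ₁
  refine condExp_state_comap_ae_eq measurable_id
    (r := fun x => ∏ i, likelihoodRatio μ₀ μ₁ (x i)) (by fun_prop) ?_
  rw [Measure.map_id, Measure.map_id, ← pi_withDensity (fun _ => μ₀) fun _ => hl,
    withDensity_likelihoodRatio hac]

theorem exists_condExp_state_agentInfo_ae_eq {μ₀ μ₁ : Measure Ω} [IsProbabilityMeasure μ₀]
    [IsProbabilityMeasure μ₁] (hac : μ₁ ≪ μ₀) (t : ℕ) (i : Fin n) :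
    ∃ γ : Outcome n Ω → ℝ≥0, Measurable[publicInfo μ₀ μ₁ t] γ ∧
      (law n μ₀ μ₁)⟦{z | state z = 1} |
          MeasurableSpace.comap (signal i) inferInstance ⊔ publicInfo μ₀ μ₁ t⟧
        =ᵐ[law n μ₀ μ₁] fun z => ((likelihoodRatio μ₀ μ₁ (signal i z) * γ z : ℝ≥0) : ℝ) /
          (1 + (likelihoodRatio μ₀ μ₁ (signal i z) * γ z : ℝ≥0)) := by
  obtain ⟨K, _, _, _, F, hF, hK⟩ := exists_publicInfo_eq_comap (n := n) μ₀ μ₁ t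
  have hl := measurable_likelihoodRatio μ₀ μ₁
  obtain ⟨γ, hγ⟩ := hF.exists_map_eval_prodMk_eq_withDensity (μ := fun _ => μ₀) (ν := fun _ => μ₁)
    (fun _ => hac) i hl (withDensity_likelihoodRatio hac).symm
  have hγ_meas : Measurable γ := measurable_of_finite γ
  refine ⟨fun z => γ (F z.2), hK ▸ hγ_meas.comp (comap_measurable _), ?_⟩
  rw [hK, comap_signal_sup_comap]
  exact condExp_state_comap_ae_eq ((measurable_pi_apply i).prodMk hF.measurable)
    (r := fun p => likelihoodRatio μ₀ μ₁ p.1 * γ p.2) (by fun_prop) hγ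

end Model

section Belief

variable {n : ℕ} {Ω : Type*} [MeasurableSpace Ω] (μ₀ μ₁ : Measure Ω)

theorem publicInfo_mono : Monotone (publicInfo (n := n) μ₀ μ₁) :=
  monotone_nat_of_le_succ fun _ => le_sup_left

/-- The increasing public information, as a filtration. -/
noncomputable def publicFiltration (n : ℕ) :
    Filtration ℕ (inferInstance : MeasurableSpace (Outcome n Ω)) where
  seq := publicInfo μ₀ μ₁
  mono' := publicInfo_mono μ₀ μ₁
  le' t := (publicInfo_le_comap_snd μ₀ μ₁ t).trans measurable_snd.comap_le

/-- The increasing information of agent `i`: its signal together with the public information. -/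
noncomputable def agentFiltration (i : Fin n) :
    Filtration ℕ (inferInstance : MeasurableSpace (Outcome n Ω)) where
  seq t := MeasurableSpace.comap (signal i) inferInstance ⊔ publicInfo μ₀ μ₁ t
  mono' _ _ hst := sup_le_sup_left (publicInfo_mono μ₀ μ₁ hst) _
  le' t := info_le μ₀ μ₁ t i

theorem publicFiltration_le_agentFiltration (i : Fin n) :
    ⨆ t, publicFiltration μ₀ μ₁ n t ≤ ⨆ t, agentFiltration μ₀ μ₁ i t :=
  iSup_mono fun _ => le_sup_right

/-- The conditional probability of the state `1` given all votes. -/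
noncomputable abbrev publicBelief (n : ℕ) : Outcome n Ω → ℝ :=
  (law n μ₀ μ₁)⟦{z | state z = 1} | ⨆ t, publicFiltration μ₀ μ₁ n t⟧

/-- The conditional probability of the state `1` given the signal of agent `i` and all votes. -/
noncomputable abbrev agentBelief (i : Fin n) : Outcome n Ω → ℝ :=
  (law n μ₀ μ₁)⟦{z | state z = 1} | ⨆ t, agentFiltration μ₀ μ₁ i t⟧

theorem iSup_agentFiltration_le (i : Fin n) :
    ⨆ t, agentFiltration μ₀ μ₁ i t ≤ (inferInstance : MeasurableSpace (Outcome n Ω)) :=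
  iSup_le (agentFiltration μ₀ μ₁ i).le

theorem measurable_vote (t : ℕ) (i : Fin n) :
    Measurable[⨆ t, publicFiltration μ₀ μ₁ n t] (vote μ₀ μ₁ t i) := by
  have hle : MeasurableSpace.comap (vote μ₀ μ₁ t i) inferInstance ≤ publicInfo μ₀ μ₁ (t - 1 + 1) :=
    le_sup_of_le_right (le_iSup (fun j => MeasurableSpace.comap
      (voteGiven μ₀ μ₁ (publicInfo μ₀ μ₁ (t - 1)) j) inferInstance) i)
  exact measurable_iff_comap_le.2 (hle.trans (le_iSup (publicFiltration μ₀ μ₁ n) (t - 1 + 1)))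

theorem measurableSet_frequently_vote_eq (i : Fin n) (b : Fin 2) :
    MeasurableSet[⨆ t, publicFiltration μ₀ μ₁ n t] {z | ∃ᶠ t in atTop, vote μ₀ μ₁ t i z = b} := by
  have hlimsup : {z | ∃ᶠ t in atTop, vote μ₀ μ₁ t i z = b} =
      limsup (fun t => vote μ₀ μ₁ t i ⁻¹' {b}) atTop := by
    ext z
    exact (mem_limsup_iff_frequently_mem (s := fun t => vote μ₀ μ₁ t i ⁻¹' {b})).symm
  rw [hlimsup]
  exact @MeasurableSet.measurableSet_limsup _ (_) _ fun t =>
    measurable_vote μ₀ μ₁ t i (measurableSet_singleton b)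

theorem measurableSet_publicBelief_eq_half :
    MeasurableSet[⨆ t, publicFiltration μ₀ μ₁ n t] {z | publicBelief μ₀ μ₁ n z = 1 / 2} :=
  stronglyMeasurable_condExp.measurable (measurableSet_singleton (1 / 2 : ℝ))

variable [IsProbabilityMeasure μ₀] [IsProbabilityMeasure μ₁]

theorem tendsto_condExp_agentBelief (i : Fin n) :
    ∀ᵐ z ∂law n μ₀ μ₁, Tendsto
      (fun t => ((law n μ₀ μ₁)⟦{z | state z = 1} | agentFiltration μ₀ μ₁ i t⟧) z)
      atTop (𝓝 (agentBelief μ₀ μ₁ i z)) :=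
  tendsto_ae_condExp _

theorem agentBelief_le_half_of_frequently (i : Fin n) :
    ∀ᵐ z ∂law n μ₀ μ₁, (∃ᶠ t in atTop, vote μ₀ μ₁ t i z = 0) → agentBelief μ₀ μ₁ i z ≤ 1 / 2 := by
  filter_upwards [tendsto_condExp_agentBelief μ₀ μ₁ i] with z hz hvote
  refine le_of_tendsto_of_frequently (hz.comp (tendsto_sub_atTop_nat 1)) (hvote.mono fun t ht => ?_)
  exact not_lt.1 fun hlt => zero_ne_one (ht.symm.trans (if_pos hlt))

theorem half_le_agentBelief_of_frequently (i : Fin n) :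
    ∀ᵐ z ∂law n μ₀ μ₁, (∃ᶠ t in atTop, vote μ₀ μ₁ t i z = 1) → 1 / 2 ≤ agentBelief μ₀ μ₁ i z := by
  filter_upwards [tendsto_condExp_agentBelief μ₀ μ₁ i] with z hz hvote
  refine ge_of_tendsto_of_frequently (hz.comp (tendsto_sub_atTop_nat 1)) (hvote.mono fun t ht => ?_)
  exact le_of_not_ge fun hle => one_ne_zero (ht.symm.trans (if_neg hle.not_gt))

theorem publicBelief_le_half_of_frequently (i : Fin n) :
    ∀ᵐ z ∂law n μ₀ μ₁, (∃ᶠ t in atTop, vote μ₀ μ₁ t i z = 0) → publicBelief μ₀ μ₁ n z ≤ 1 / 2 :=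
  condExp_mem_of_condExp_mem_on (publicFiltration_le_agentFiltration μ₀ μ₁ i)
    (iSup_agentFiltration_le μ₀ μ₁ i) (measurableSet_frequently_vote_eq μ₀ μ₁ i 0) isClosed_Iic
    (convex_Iic (1 / 2 : ℝ)) (agentBelief_le_half_of_frequently μ₀ μ₁ i)

theorem half_le_publicBelief_of_frequently (i : Fin n) :
    ∀ᵐ z ∂law n μ₀ μ₁, (∃ᶠ t in atTop, vote μ₀ μ₁ t i z = 1) → 1 / 2 ≤ publicBelief μ₀ μ₁ n z :=
  condExp_mem_of_condExp_mem_on (publicFiltration_le_agentFiltration μ₀ μ₁ i)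
    (iSup_agentFiltration_le μ₀ μ₁ i) (measurableSet_frequently_vote_eq μ₀ μ₁ i 1) isClosed_Ici
    (convex_Ici (1 / 2 : ℝ)) (half_le_agentBelief_of_frequently μ₀ μ₁ i)

theorem eventually_vote_eq_of_publicBelief_ne_half :
    ∀ᵐ z ∂law n μ₀ μ₁, publicBelief μ₀ μ₁ n z ≠ 1 / 2 →
      ∃ V : Fin 2, ∀ᶠ t in atTop, ∀ i, vote μ₀ μ₁ t i z = V := by
  filter_upwards [ae_all_iff.2 (publicBelief_le_half_of_frequently (n := n) μ₀ μ₁),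
    ae_all_iff.2 (half_le_publicBelief_of_frequently (n := n) μ₀ μ₁)] with z hzero hone hne
  obtain hlt | hgt := hne.lt_or_gt
  · refine ⟨0, eventually_all.2 fun i => ?_⟩
    filter_upwards [not_frequently.1 fun hfreq => (hone i hfreq).not_gt hlt] with t ht
    exact (Fin.exists_fin_two.1 ⟨_, rfl⟩).resolve_right ht
  · refine ⟨1, eventually_all.2 fun i => ?_⟩
    filter_upwards [not_frequently.1 fun hfreq => (hzero i hfreq).not_gt hgt] with t ht
    exact (Fin.exists_fin_two.1 ⟨_, rfl⟩).resolve_left ht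

theorem agentBelief_eq_half_of_publicBelief_eq_half (i : Fin n) :
    ∀ᵐ z ∂law n μ₀ μ₁, publicBelief μ₀ μ₁ n z = 1 / 2 → agentBelief μ₀ μ₁ i z = 1 / 2 := by
  have hpub := (publicFiltration_le_agentFiltration μ₀ μ₁ i).trans (iSup_agentFiltration_le μ₀ μ₁ i)
  have hint : Integrable ({z | state z = 1}.indicator fun _ => (1 : ℝ)) (law n μ₀ μ₁) :=
    (integrable_const 1).indicator measurableSet_state
  have hmeas (b : Fin 2) := (measurableSet_publicBelief_eq_half μ₀ μ₁).inter
    (measurableSet_frequently_vote_eq μ₀ μ₁ i b)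
  have hzero := condExp_eq_on_of_le_on (iSup_agentFiltration_le μ₀ μ₁ i) hpub hint
    (publicFiltration_le_agentFiltration μ₀ μ₁ i _ (hmeas 0)) (hmeas 0)
    ((agentBelief_le_half_of_frequently μ₀ μ₁ i).mono fun z hz ⟨hhalf, hfreq⟩ =>
      (hz hfreq).trans_eq hhalf.symm)
  have hone := condExp_eq_on_of_le_on hpub (iSup_agentFiltration_le μ₀ μ₁ i) hint
    (hmeas 1) (publicFiltration_le_agentFiltration μ₀ μ₁ i _ (hmeas 1))
    ((half_le_agentBelief_of_frequently μ₀ μ₁ i).mono fun z hz ⟨hhalf, hfreq⟩ =>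
      hhalf.trans_le (hz hfreq))
  filter_upwards [hzero, hone] with z hz₀ hz₁ hhalf
  have hvote : ∃ᶠ t in atTop, vote μ₀ μ₁ t i z = 0 ∨ vote μ₀ μ₁ t i z = 1 :=
    .of_forall fun t => Fin.exists_fin_two.1 ⟨_, rfl⟩
  obtain hfreq | hfreq := frequently_or_distrib.1 hvote
  · exact (hz₀ ⟨hhalf, hfreq⟩).trans hhalf
  · exact (hz₁ ⟨hhalf, hfreq⟩).symm.trans hhalf

end Belief

section LikelihoodRatio

theorem tendsto_one_of_tendsto_div_one_add {ι : Type*} {f : Filter ι} {L : ι → ℝ≥0}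
    (h : Tendsto (fun t => (L t : ℝ) / (1 + L t)) f (𝓝 (1 / 2))) :
    Tendsto (fun t => (L t : ℝ)) f (𝓝 1) := by
  have hodds := h.div (h.const_sub 1) (by norm_num)
  rw [show (1 / 2 : ℝ) / (1 - 1 / 2) = 1 by norm_num] at hodds
  refine hodds.congr fun t => ?_
  rw [Pi.div_apply]
  field

variable {n : ℕ} {Ω : Type*} [MeasurableSpace Ω] {μ₀ μ₁ : Measure Ω} [IsProbabilityMeasure μ₀]
  [IsProbabilityMeasure μ₁]

/-- Where the belief of agent `i` tends to `1/2`, its odds, the likelihood ratio of its signal times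
a publicly known factor, tend to `1`: the likelihood ratio is the reciprocal of a public limit. -/
theorem exists_stronglyMeasurable_eq_likelihoodRatio (hac : μ₁ ≪ μ₀) (i : Fin n) :
    ∃ w : Outcome n Ω → ℝ, StronglyMeasurable[⨆ t, publicFiltration μ₀ μ₁ n t] w ∧
      ∀ᵐ z ∂law n μ₀ μ₁, agentBelief μ₀ μ₁ i z = 1 / 2 →
        w z = likelihoodRatio μ₀ μ₁ (signal i z) := by
  choose γ hγ_meas hγ using fun t => exists_condExp_state_agentInfo_ae_eq (n := n) hac t i
  have hlim : StronglyMeasurable[⨆ t, publicFiltration μ₀ μ₁ n t]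
      fun z => limUnder atTop fun t => (γ t z : ℝ) :=
    @StronglyMeasurable.limUnder _ _ _ (⨆ t, publicFiltration μ₀ μ₁ n t) _ _ _ _ _ _ _ fun t =>
      ((hγ_meas t).mono (le_iSup (publicFiltration μ₀ μ₁ n) t) le_rfl).coe_nnreal_real
        |>.stronglyMeasurable
  refine ⟨fun z => (limUnder atTop fun t => (γ t z : ℝ))⁻¹,
    hlim.measurable.inv.stronglyMeasurable, ?_⟩
  filter_upwards [ae_all_iff.2 hγ, tendsto_condExp_agentBelief μ₀ μ₁ i] with z hz hbelief hhalf
  set l : ℝ≥0 := likelihoodRatio μ₀ μ₁ (signal i z)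
  have hlγ : Tendsto (fun t => ((l * γ t z : ℝ≥0) : ℝ)) atTop (𝓝 1) :=
    tendsto_one_of_tendsto_div_one_add (hhalf ▸ hbelief.congr hz)
  have hl : (l : ℝ) ≠ 0 := fun h0 => by
    simp [NNReal.coe_eq_zero.1 h0, tendsto_const_nhds_iff] at hlγ
  have hγ_lim : Tendsto (fun t => (γ t z : ℝ)) atTop (𝓝 (l : ℝ)⁻¹) := by
    simpa [hl] using hlγ.const_mul (l : ℝ)⁻¹
  rw [hγ_lim.limUnder_eq, inv_inv]

theorem prod_rnDeriv_eq_one_of_publicBelief_eq_half (hac : μ₁ ≪ μ₀) :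
    ∀ᵐ z ∂law n μ₀ μ₁, publicBelief μ₀ μ₁ n z = 1 / 2 →
      ∏ i, μ₁.rnDeriv μ₀ (signal i z) = 1 := by
  choose w hw_meas hw using exists_stronglyMeasurable_eq_likelihoodRatio (n := n) hac
  have hprod : ∀ᵐ z ∂law n μ₀ μ₁, publicBelief μ₀ μ₁ n z = 1 / 2 →
      ∏ i, w i z = (∏ i, likelihoodRatio μ₀ μ₁ (signal i z) : ℝ≥0) := by
    filter_upwards [ae_all_iff.2 hw, ae_all_iff.2
      (agentBelief_eq_half_of_publicBelief_eq_half (n := n) μ₀ μ₁)] with z hwz hbelief hhalf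
    rw [NNReal.coe_prod, Finset.prod_congr rfl fun i _ => hwz i (hbelief i hhalf)]
  have hprod_meas : Measurable[⨆ t, publicFiltration μ₀ μ₁ n t] fun z => ∏ i, w i z :=
    Finset.measurable_fun_prod _ fun i _ => (hw_meas i).measurable
  have hpublic := condExp_eq_on_of_eq_stronglyMeasurable_on (P := law n μ₀ μ₁)
    (f := {z | state z = 1}.indicator fun _ => (1 : ℝ))
    (iSup_le (publicInfo_le_comap_snd μ₀ μ₁)) measurable_snd.comap_le
    (measurableSet_publicBelief_eq_half μ₀ μ₁)
    (hprod_meas.div (hprod_meas.const_add 1)).stronglyMeasurable (by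
      filter_upwards [hprod, condExp_state_comap_snd_ae_eq (n := n) hac] with z hz hpool hhalf
      rw [hpool, Pi.div_apply, hz hhalf])
  filter_upwards [hprod, hpublic] with z hz hbelief hhalf
  have hodds := (hbelief hhalf).symm.trans hhalf
  rw [Pi.div_apply, hz hhalf, div_eq_div_iff (by positivity) two_ne_zero] at hodds
  have hone : ∏ i, likelihoodRatio μ₀ μ₁ (signal i z) = 1 := by
    rw [← NNReal.coe_inj, NNReal.coe_one]; linarith
  rwa [← ENNReal.toNNReal_eq_one_iff, ENNReal.toNNReal_prod]

end LikelihoodRatio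

section Admissible

variable {Ω : Type*} [MeasurableSpace Ω] {μ₀ μ₁ : Measure Ω}

theorem IsAdmissible.measure_rnDeriv_preimage_singleton (h : IsAdmissible μ₀ μ₁) (c : ℝ≥0∞) :
    μ₀ (μ₁.rnDeriv μ₀ ⁻¹' {c}) = 0 ∧ μ₁ (μ₁.rnDeriv μ₀ ⁻¹' {c}) = 0 := by
  have hsub : μ₁.rnDeriv μ₀ ⁻¹' {c} ⊆ llr μ₁ μ₀ ⁻¹' {Real.log c.toReal} := fun a ha => by
    rw [mem_preimage, llr, show μ₁.rnDeriv μ₀ a = c from ha, mem_singleton_iff]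
  have hllr := h.nonatomic (Real.log c.toReal)
  rw [Measure.map_apply (measurable_llr _ _) (measurableSet_singleton _)] at hllr
  simpa using measure_mono_null hsub hllr

theorem IsAdmissible.ae_prod_rnDeriv_ne_one [IsProbabilityMeasure μ₀] [IsProbabilityMeasure μ₁]
    (h : IsAdmissible μ₀ μ₁) (m : ℕ) :
    ∀ᵐ z ∂law (m + 1) μ₀ μ₁, ∏ i, μ₁.rnDeriv μ₀ (signal i z) ≠ 1 :=
  have hmeas := μ₁.measurable_rnDeriv μ₀
  ae_law_of_ae_pi
    (ae_pi_prod_ne_one _ hmeas fun c => (h.measure_rnDeriv_preimage_singleton c).1)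
    (ae_pi_prod_ne_one _ hmeas fun c => (h.measure_rnDeriv_preimage_singleton c).2)

end Admissible

end RepeatedVoting

theorem theorem1_general {Ω : Type*} [MeasurableSpace Ω] (n : ℕ) (μ₀ μ₁ : Measure Ω)
    [IsProbabilityMeasure μ₀] [IsProbabilityMeasure μ₁] (hac : μ₁ ≪ μ₀) :
    ∀ᵐ z ∂(RepeatedVoting.law n μ₀ μ₁),
      ∏ i, μ₁.rnDeriv μ₀ (RepeatedVoting.signal i z) ≠ 1 →
        ∃ tᵤ : ℕ, 1 ≤ tᵤ ∧ ∃ V : Fin 2,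
          ∀ t : ℕ, tᵤ ≤ t → ∀ i : Fin n, RepeatedVoting.vote μ₀ μ₁ t i z = V := by
  filter_upwards [RepeatedVoting.eventually_vote_eq_of_publicBelief_ne_half (n := n) μ₀ μ₁,
    RepeatedVoting.prod_rnDeriv_eq_one_of_publicBelief_eq_half hac] with z hunanimous hprod hne
  obtain ⟨V, hV⟩ := hunanimous (mt hprod hne)
  obtain ⟨T, hT⟩ := Filter.eventually_atTop.1 hV
  exact ⟨max T 1, le_max_right T 1, V, fun t ht => hT t ((le_max_left T 1).trans ht)⟩

theorem theorem1 {Ω : Type*} [MeasurableSpace Ω] (n : ℕ) (μ₀ μ₁ : Measure Ω)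
    [IsProbabilityMeasure μ₀] [IsProbabilityMeasure μ₁]
    (h : RepeatedVoting.IsAdmissible μ₀ μ₁) :
    ∀ᵐ z ∂(RepeatedVoting.law n μ₀ μ₁), ∃ tᵤ : ℕ, 1 ≤ tᵤ ∧ ∃ V : Fin 2,
      ∀ t : ℕ, tᵤ ≤ t → ∀ i : Fin n, RepeatedVoting.vote μ₀ μ₁ t i z = V := by
  obtain _ | m := n
  · exact ae_of_all _ fun z => ⟨1, le_rfl, 0, fun t _ i => i.elim0⟩
  · exact (theorem1_general _ μ₀ μ₁ h.absolutelyContinuous).mp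
      ((h.ae_prod_rnDeriv_ne_one m).mono fun z hne hunanimous => hunanimous hne)
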